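/- Let $k$ be a field. For an associative unital $k$-algebra $A$, let $\mathrm{Der}(A)$ be the Lie algebra of all $k$-linear maps $D\colon A\to A$ with $D(ab)=D(a)b+aD(b)$ for all $a,b\in A$, with bracket $[D,D']=DD'-D'D$. Let $\mathrm{AID}(A)\subseteq\mathrm{Der}(A)$ be the Lie subalgebra of almost inner derivations, that is, of those $D\in\mathrm{Der}(A)$ such that for every $a\in A$ there is an $m\in A$, which may depend on $a$, with $D(a)=am-ma$. Let $\mathrm{ad}(A)$ be the Lie ideal of $\mathrm{AID}(A)$ consisting of the inner derivations $a\mapsto am-ma$, where $m\in A$ is fixed. The quotient Lie algebra $\mathrm{Sha}_a(A):=\mathrm{AID}(A)/\mathrm{ad}(A)$ is called the additive Tate–Shafarevich algebra of $A$. **Corollary 3.5.** Over every field $k$ there exist finitely generated associative unital $k$-algebras $A$ with $\mathrm{Sha}_a(A)\neq 0$. -/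

import Mathlib

universe u

section TateShafarevich

attribute [local instance] LieRing.ofAssociativeRing

variable (k A : Type*) [Field k] [Ring A] [Algebra k A]

/-- `Der(A)`: the `k`-linear maps `D : A → A` with `D (a b) = D a b + a D b`, a Lie algebra under
`[D, D'] = D D' - D' D` (the bracket of `Module.End k A`). -/
def assocDer : LieSubalgebra k (Module.End k A) where
  carrier := {D | ∀ a b : A, D (a * b) = D a * b + a * D b}
  zero_mem' := by simp
  add_mem' := by
    intro D D' hD hD' a b
    simp only [LinearMap.add_apply, hD a b, hD' a b]
    noncomm_ring
  smul_mem' := by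
    intro c D hD a b
    simp only [LinearMap.smul_apply, hD a b, smul_add, smul_mul_assoc, mul_smul_comm]
  lie_mem' := by
    intro D D' hD hD' a b
    have h : ∀ x y : A, D (x * y) = D x * y + x * D y := hD
    have h' : ∀ x y : A, D' (x * y) = D' x * y + x * D' y := hD'
    simp only [Ring.lie_def, LinearMap.sub_apply, Module.End.mul_apply, h, h', map_add]
    noncomm_ring

/-- `AID(A)`: the almost inner derivations, i.e. the derivations `D` such that for every `a` there
is an `m`, possibly depending on `a`, with `D a = a m - m a`. It is a Lie subalgebra of `Der(A)`. -/
def almostInnerDer : LieSubalgebra k (assocDer k A) where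
  carrier := {D | ∀ a : A, ∃ m : A, D.1 a = a * m - m * a}
  zero_mem' := fun a => ⟨0, by simp⟩
  add_mem' := by
    intro D D' hD hD' a
    obtain ⟨m, hm⟩ := hD a
    obtain ⟨m', hm'⟩ := hD' a
    refine ⟨m + m', ?_⟩
    change D.1 a + D'.1 a = _
    rw [hm, hm']
    noncomm_ring
  smul_mem' := by
    intro c D hD a
    obtain ⟨m, hm⟩ := hD a
    refine ⟨c • m, ?_⟩
    change c • D.1 a = _
    rw [hm, smul_sub, mul_smul_comm, smul_mul_assoc]
  lie_mem' := by
    intro D D' hD hD' a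
    obtain ⟨m, hm⟩ := hD a
    obtain ⟨m', hm'⟩ := hD' a
    have h : ∀ x y : A, D.1 (x * y) = D.1 x * y + x * D.1 y := D.2
    have h' : ∀ x y : A, D'.1 (x * y) = D'.1 x * y + x * D'.1 y := D'.2
    refine ⟨m * m' - m' * m - D'.1 m + D.1 m', ?_⟩
    change D.1 (D'.1 a) - D'.1 (D.1 a) = _
    rw [hm, hm', map_sub, map_sub, h, h, h', h', hm, hm']
    noncomm_ring

/-- `ad(A)`: the inner derivations `a ↦ a m - m a`, for one `m` that serves all `a`, as a Lie ideal
of `AID(A)`. -/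
def innerDer : LieIdeal k (almostInnerDer k A) where
  carrier := {D | ∃ m : A, ∀ a : A, D.1.1 a = a * m - m * a}
  zero_mem' := ⟨0, fun a => by simp⟩
  add_mem' := by
    rintro D D' ⟨m, hm⟩ ⟨m', hm'⟩
    refine ⟨m + m', fun a => ?_⟩
    change D.1.1 a + D'.1.1 a = _
    rw [hm, hm']
    noncomm_ring
  smul_mem' := by
    rintro c D ⟨m, hm⟩
    refine ⟨c • m, fun a => ?_⟩
    change c • D.1.1 a = _
    rw [hm, smul_sub, mul_smul_comm, smul_mul_assoc]
  lie_mem := by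
    rintro D D' ⟨m, hm⟩
    have h : ∀ x y : A, D.1.1 (x * y) = D.1.1 x * y + x * D.1.1 y := D.1.2
    refine ⟨D.1.1 m, fun a => ?_⟩
    change D.1.1 (D'.1.1 a) - D'.1.1 (D.1.1 a) = _
    rw [hm, hm, map_sub, h, h]
    noncomm_ring

/-- The additive Tate–Shafarevich algebra `Sha_a(A) = AID(A) / ad(A)`, a Lie algebra over `k`. -/
abbrev AdditiveSha : Type _ := almostInnerDer k A ⧸ innerDer k A

end TateShafarevich

/-!
The witness is the seven-dimensional algebra with basis `1, x, y, s, t, p, q` whose only nonzero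
products of basis elements other than `1` are `x s = p`, `y s = q` and `y t = p`. It is realised by
`5 × 5` matrices. The derivation `D` sends `x` to `p` and kills the other basis elements.

For fixed `m = β₁ s + β₂ t`, the commutator with `m` sends `α₁ x + α₂ y` to
`(α₁ β₁ + α₂ β₂) p + α₂ β₁ q`. These operators form the space of matrices
`β₁ • 1 + β₂ • N`, with `N` a nonzero nilpotent `2 × 2` matrix, and this space is not reflexive: the
matrix unit of `D` lies outside it, yet on each single vector it agrees with a member of it. If
`α₂ = 0`, take `m = s`; otherwise take `m = (α₁ / α₂) t` (`exists_commutator_eq`). No `m` serves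
both `x` and `y`: the first forces `β₁ = 1`, the second `β₁ = 0` (`not_forall_commutator_eq`).
-/

namespace NonreflexiveAlgebra

section

variable {k : Type*} [Field k]

/-- The matrix of `c + a₁ x + a₂ y + b₁ s + b₂ t + p₀ p + q₀ q`. Its `(2, 2, 1)`-block form is upper
triangular with `c` on the diagonal; the block `!![a₁, a₂; a₂, 0]` applied to the column `![b₁, b₂]`
gives the products of `x, y` with `s, t`. -/
def toMatrix (c a₁ a₂ b₁ b₂ p₀ q₀ : k) : Matrix (Fin 5) (Fin 5) k :=
  !![c, 0, a₁, a₂, p₀;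
     0, c, a₂, 0, q₀;
     0, 0, c, 0, b₁;
     0, 0, 0, c, b₂;
     0, 0, 0, 0, c]

theorem toMatrix_mul (c a₁ a₂ b₁ b₂ p₀ q₀ c' a₁' a₂' b₁' b₂' p₀' q₀' : k) :
    toMatrix c a₁ a₂ b₁ b₂ p₀ q₀ * toMatrix c' a₁' a₂' b₁' b₂' p₀' q₀' =
      toMatrix (c * c') (c * a₁' + a₁ * c') (c * a₂' + a₂ * c') (c * b₁' + b₁ * c')
        (c * b₂' + b₂ * c') (c * p₀' + a₁ * b₁' + a₂ * b₂' + p₀ * c')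
        (c * q₀' + a₂ * b₁' + q₀ * c') := by
  ext i j
  fin_cases i <;> fin_cases j <;> simp [toMatrix, Matrix.mul_apply, Fin.sum_univ_five]

theorem toMatrix_add (c a₁ a₂ b₁ b₂ p₀ q₀ c' a₁' a₂' b₁' b₂' p₀' q₀' : k) :
    toMatrix c a₁ a₂ b₁ b₂ p₀ q₀ + toMatrix c' a₁' a₂' b₁' b₂' p₀' q₀' =
      toMatrix (c + c') (a₁ + a₁') (a₂ + a₂') (b₁ + b₁') (b₂ + b₂') (p₀ + p₀') (q₀ + q₀') := by
  ext i j
  fin_cases i <;> fin_cases j <;> simp [toMatrix]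

theorem toMatrix_sub (c a₁ a₂ b₁ b₂ p₀ q₀ c' a₁' a₂' b₁' b₂' p₀' q₀' : k) :
    toMatrix c a₁ a₂ b₁ b₂ p₀ q₀ - toMatrix c' a₁' a₂' b₁' b₂' p₀' q₀' =
      toMatrix (c - c') (a₁ - a₁') (a₂ - a₂') (b₁ - b₁') (b₂ - b₂') (p₀ - p₀') (q₀ - q₀') := by
  ext i j
  fin_cases i <;> fin_cases j <;> simp [toMatrix]

theorem algebraMap_eq_toMatrix (r : k) :
    algebraMap k (Matrix (Fin 5) (Fin 5) k) r = toMatrix r 0 0 0 0 0 0 := by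
  ext i j
  fin_cases i <;> fin_cases j <;> simp [toMatrix, Matrix.algebraMap_matrix_apply]

variable (k) in
/-- The seven-dimensional algebra with basis `1, x, y, s, t, p, q`, as an algebra of matrices. -/
def algebra : Subalgebra k (Matrix (Fin 5) (Fin 5) k) where
  carrier := {X | ∃ c a₁ a₂ b₁ b₂ p₀ q₀ : k, X = toMatrix c a₁ a₂ b₁ b₂ p₀ q₀}
  mul_mem' := by
    rintro _ _ ⟨c, a₁, a₂, b₁, b₂, p₀, q₀, rfl⟩ ⟨c', a₁', a₂', b₁', b₂', p₀', q₀', rfl⟩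
    exact ⟨_, _, _, _, _, _, _, toMatrix_mul ..⟩
  add_mem' := by
    rintro _ _ ⟨c, a₁, a₂, b₁, b₂, p₀, q₀, rfl⟩ ⟨c', a₁', a₂', b₁', b₂', p₀', q₀', rfl⟩
    exact ⟨_, _, _, _, _, _, _, toMatrix_add ..⟩
  algebraMap_mem' r := ⟨_, _, _, _, _, _, _, algebraMap_eq_toMatrix r⟩

/-- `toMatrix`, with values in `algebra k`. -/
def element (c a₁ a₂ b₁ b₂ p₀ q₀ : k) : algebra k :=
  ⟨toMatrix c a₁ a₂ b₁ b₂ p₀ q₀, _, _, _, _, _, _, _, rfl⟩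

theorem exists_eq_element (X : algebra k) :
    ∃ c a₁ a₂ b₁ b₂ p₀ q₀ : k, X = element c a₁ a₂ b₁ b₂ p₀ q₀ := by
  obtain ⟨_, c, a₁, a₂, b₁, b₂, p₀, q₀, rfl⟩ := X
  exact ⟨c, a₁, a₂, b₁, b₂, p₀, q₀, rfl⟩

theorem element_mul (c a₁ a₂ b₁ b₂ p₀ q₀ c' a₁' a₂' b₁' b₂' p₀' q₀' : k) :
    element c a₁ a₂ b₁ b₂ p₀ q₀ * element c' a₁' a₂' b₁' b₂' p₀' q₀' =
      element (c * c') (c * a₁' + a₁ * c') (c * a₂' + a₂ * c') (c * b₁' + b₁ * c')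
        (c * b₂' + b₂ * c') (c * p₀' + a₁ * b₁' + a₂ * b₂' + p₀ * c')
        (c * q₀' + a₂ * b₁' + q₀ * c') :=
  Subtype.ext (toMatrix_mul ..)

theorem element_add (c a₁ a₂ b₁ b₂ p₀ q₀ c' a₁' a₂' b₁' b₂' p₀' q₀' : k) :
    element c a₁ a₂ b₁ b₂ p₀ q₀ + element c' a₁' a₂' b₁' b₂' p₀' q₀' =
      element (c + c') (a₁ + a₁') (a₂ + a₂') (b₁ + b₁') (b₂ + b₂') (p₀ + p₀') (q₀ + q₀') :=
  Subtype.ext (toMatrix_add ..)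

theorem element_commutator (c a₁ a₂ b₁ b₂ p₀ q₀ c' a₁' a₂' b₁' b₂' p₀' q₀' : k) :
    element c a₁ a₂ b₁ b₂ p₀ q₀ * element c' a₁' a₂' b₁' b₂' p₀' q₀' -
        element c' a₁' a₂' b₁' b₂' p₀' q₀' * element c a₁ a₂ b₁ b₂ p₀ q₀ =
      element 0 0 0 0 0 (a₁ * b₁' + a₂ * b₂' - a₁' * b₁ - a₂' * b₂) (a₂ * b₁' - a₂' * b₁) := by
  rw [element_mul, element_mul]
  refine Subtype.ext ((toMatrix_sub ..).trans ?_)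
  unfold element
  congr 1 <;> ring

variable (k) in
/-- The `k`-linear map with `x ↦ p` that kills the other basis elements. The entry `(0, 2)` of a
matrix in `algebra k` is its coefficient at `x`. -/
def derivation : Module.End k (algebra k) where
  toFun X := element 0 0 0 0 0 (X.1 0 2) 0
  map_add' X Y := by simp [element_add]
  map_smul' r X := by
    refine Subtype.ext ?_
    ext i j
    fin_cases i <;> fin_cases j <;> simp [element, toMatrix]

theorem derivation_element (c a₁ a₂ b₁ b₂ p₀ q₀ : k) :
    derivation k (element c a₁ a₂ b₁ b₂ p₀ q₀) = element 0 0 0 0 0 a₁ 0 :=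
  rfl

theorem derivation_mem_assocDer : derivation k ∈ assocDer k (algebra k) := by
  intro X Y
  obtain ⟨c, a₁, a₂, b₁, b₂, p₀, q₀, rfl⟩ := exists_eq_element X
  obtain ⟨c', a₁', a₂', b₁', b₂', p₀', q₀', rfl⟩ := exists_eq_element Y
  simp only [element_mul, derivation_element, element_add]
  congr 1 <;> ring

theorem exists_commutator_eq (X : algebra k) :
    ∃ m : algebra k, derivation k X = X * m - m * X := by
  obtain ⟨c, a₁, a₂, b₁, b₂, p₀, q₀, rfl⟩ := exists_eq_element X
  by_cases h : a₂ = 0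
  · refine ⟨element 0 0 0 1 0 0 0, ?_⟩
    simp [derivation_element, element_commutator, h]
  · refine ⟨element 0 0 0 0 (a₁ / a₂) 0 0, ?_⟩
    simp [derivation_element, element_commutator, mul_div_cancel₀, h]

theorem not_forall_commutator_eq (m : algebra k) :
    ¬ ∀ X : algebra k, derivation k X = X * m - m * X := by
  intro h
  obtain ⟨c, a₁, a₂, b₁, b₂, p₀, q₀, rfl⟩ := exists_eq_element m
  have hx := h (element 0 1 0 0 0 0 0)
  have hy := h (element 0 0 1 0 0 0 0)
  rw [derivation_element, element_commutator] at hx hy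
  -- Compare the coefficients at `p` for `x` and at `q` for `y`.
  have hp : (1 : k) = b₁ := by simpa [element, toMatrix] using congrArg (fun X => X.1 0 4) hx
  have hq : 0 = b₁ := by simpa [element, toMatrix] using congrArg (fun X => X.1 1 4) hy
  exact one_ne_zero (hp.trans hq.symm)

theorem nontrivial_additiveSha : Nontrivial (AdditiveSha k (algebra k)) := by
  let D : almostInnerDer k (algebra k) :=
    ⟨⟨derivation k, derivation_mem_assocDer⟩, exists_commutator_eq⟩
  refine ⟨⟨LieSubmodule.Quotient.mk D, 0, fun h => ?_⟩⟩
  obtain ⟨m, hm⟩ : D ∈ innerDer k (algebra k) := LieSubmodule.Quotient.mk_eq_zero'.1 h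
  exact not_forall_commutator_eq m hm

end

end NonreflexiveAlgebra

theorem corollary3p5 (k : Type u) [Field k] :
    ∃ (A : Type u) (_ : Ring A) (_ : Algebra k A),
      Algebra.FiniteType k A ∧ Nontrivial (AdditiveSha k A) :=
  -- A subalgebra of a matrix algebra is finite-dimensional, hence finitely generated.
  ⟨NonreflexiveAlgebra.algebra k, inferInstance, inferInstance, inferInstance,
    NonreflexiveAlgebra.nontrivial_additiveSha⟩
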